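/- Consider two-armed bandits with Bernoulli rewards. An instance is a pair $\mu=(\mu_1,\mu_2)\in\Lambda=\{\mu\in(0,1)^2:\mu_1\neq\mu_2\}$. A (possibly randomized) algorithm with budget $T$ chooses in each round $t\le T$ an arm $A_t\in\{1,2\}$ on the basis of the past arms and rewards, receives a Bernoulli reward of mean $\mu_{A_t}$, and after $T$ rounds recommends an arm $\hat\imath$; the rules may depend on $T$ but not on $\mu$. Let $p_{\mu,T}$ be the probability under $\mu$ that $\hat\imath$ is not the arm with the highest mean, and let $\omega_2(T)$ be the fraction of the $T$ rounds in which arm $2$ is pulled. The algorithm is *consistent* if $\lim_{T\to\infty}p_{\mu,T}=0$ for every $\mu\in\Lambda$. It is *stable* if for every $a\in(0,1)$ both of the following hold: (A) there is a sequence $\lambda^{(n)}\in\Lambda$ with $\lambda^{(n)}_1>\lambda^{(n)}_2$, $\lambda^{(n)}\to(a,a)$ and $\lim_{n\to\infty}\lim_{T\to\infty}\mathbb E_{\lambda^{(n)}}[\omega_2(T)]=\tfrac12$; (B) there is a sequence $\pi^{(n)}\in\Lambda$ with $\pi^{(n)}_1<\pi^{(n)}_2$, $\pi^{(n)}\to(a,a)$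 and $\lim_{n\to\infty}\lim_{T\to\infty}\mathbb E_{\pi^{(n)}}[\omega_2(T)]=\tfrac12$. Here $\lim_n\lim_T u_{n,T}=\tfrac12$ means: for every $\varepsilon>0$ there is $N$ such that for all $n\ge N$ there is $T_n$ with $|u_{n,T}-\tfrac12|<\varepsilon$ for all $T\ge T_n$. For $x\in[0,1]$ let $g(x,\mu)=\inf_{\lambda\in[0,1]}\big\{(1-x)\,d(\lambda,\mu_1)+x\,d(\lambda,\mu_2)\big\}$, where $d(p,q)=p\log\frac pq+(1-p)\log\frac{1-p}{1-q}$ is the Kullback–Leibler divergence between Bernoulli laws (with $0\log 0=0$). **Theorem.** For every consistent and stable algorithm and every instance $\mu\in\Lambda$, $$\limsup_{T\to\infty}\frac1T\log\frac1{p_{\mu,T}}\ \le\ g\big(\tfrac12,\mu\big)$$ (where $\log\frac10=+\infty$), and this is the rate attained by the uniform sampling algorithm, which pulls the two arms in turn and recommends the arm with the higher empirical mean (arm $1$ in case of a tie): its error probability $p^{\mathrm{unif}}_{\mu,T}$ satisfies $$\lim_{T\to\infty}\frac1T\log\frac1{p^{\mathrm{unif}}_{\mu,T}}=g\big(\tfrac12,\mu\big).$$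 In particular, on no instance does a consistent and stable algorithm have a larger error exponent than uniform sampling. -/

import Mathlib

open Filter Topology
open scoped ENNReal

namespace TwoArmBandit

/-- An instance: two Bernoulli arms (indexed by `0` and `1`) with distinct means in `(0, 1)`. -/
structure Instance where
  mean : Fin 2 → ℝ
  mean_mem : ∀ k, mean k ∈ Set.Ioo (0 : ℝ) 1
  mean_ne : mean 0 ≠ mean 1

namespace Instance

/-- The arm with the highest mean. -/
noncomputable def bestArm (μ : Instance) : Fin 2 :=
  if μ.mean 1 < μ.mean 0 then 0 else 1

/-- The Bernoulli law of a reward of arm `k` (`true` is the reward `1`, `false` the reward `0`). -/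
noncomputable def rewardLaw (μ : Instance) (k : Fin 2) : PMF Bool :=
  PMF.ofFintype
    (fun b => if b then ENNReal.ofReal (μ.mean k) else ENNReal.ofReal (1 - μ.mean k)) (by
      have h := μ.mean_mem k
      rw [Fintype.sum_bool, if_pos rfl, if_neg Bool.false_ne_true,
        ← ENNReal.ofReal_add h.1.le (by linarith [h.2])]
      simp)

end Instance

/-- What is observed in `t` rounds: in each round, the pulled arm and its reward. -/
abbrev History (t : ℕ) : Type := Fin t → Fin 2 × Bool

/-- The number of pulls of arm `k`. -/
def History.pulls {t : ℕ} (h : History t) (k : Fin 2) : ℕ :=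
  (Finset.univ.filter fun s => (h s).1 = k).card

/-- The cumulated reward collected from arm `k`. -/
def History.reward {t : ℕ} (h : History t) (k : Fin 2) : ℕ :=
  (Finset.univ.filter fun s => h s = (k, true)).card

/-- The empirical mean of arm `k`. -/
noncomputable def History.empMean {t : ℕ} (h : History t) (k : Fin 2) : ℝ :=
  (h.reward k : ℝ) / (h.pulls k : ℝ)

/-- An algorithm for best-arm identification with fixed budget, possibly randomized. For a budget
`T`, `sample T t h` is the law of the arm pulled after the first `t < T` rounds resulted in `h`, and
`recommend T h` is the law of the arm recommended after the `T` rounds. The instance is unknown to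
the algorithm; the budget is known. -/
structure Algorithm where
  sample : (T t : ℕ) → History t → PMF (Fin 2)
  recommend : (T : ℕ) → History T → PMF (Fin 2)

namespace Algorithm

/-- The law of the history of the first `t` rounds when the algorithm is run with budget `T`. -/
noncomputable def historyLaw (A : Algorithm) (μ : Instance) (T : ℕ) : (t : ℕ) → PMF (History t)
  | 0 => PMF.pure Fin.elim0
  | t + 1 => (A.historyLaw μ T t).bind fun h =>
      (A.sample T t h).bind fun k =>
        (μ.rewardLaw k).bind fun b =>
          PMF.pure (Fin.snoc (α := fun _ => Fin 2 × Bool) h (k, b))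

/-- The law of the recommended arm. -/
noncomputable def outputLaw (A : Algorithm) (μ : Instance) (T : ℕ) : PMF (Fin 2) :=
  (A.historyLaw μ T T).bind (A.recommend T)

/-- The error probability `p_{μ,T}`: the recommended arm is not the best one. -/
noncomputable def errorProb (A : Algorithm) (μ : Instance) (T : ℕ) : ℝ≥0∞ :=
  (A.outputLaw μ T).toMeasure {k | k ≠ μ.bestArm}

/-- The expected proportion `𝔼_μ[ω_k(T)]` of the `T` rounds in which arm `k` is pulled. -/
noncomputable def expectedProportion (A : Algorithm) (μ : Instance) (k : Fin 2) (T : ℕ) : ℝ :=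
  ∑ h : History T, (A.historyLaw μ T T h).toReal * ((h.pulls k : ℝ) / (T : ℝ))

/-- `log (1 / p_{μ,T}) / T`, which is `⊤` when the error probability vanishes (and `1 ≤ T`). -/
noncomputable def errorRate (A : Algorithm) (μ : Instance) (T : ℕ) : EReal :=
  -ENNReal.log (A.errorProb μ T) / (T : EReal)

/-- On every instance, the error probability tends to `0` as the budget grows. -/
def IsConsistent (A : Algorithm) : Prop :=
  ∀ μ : Instance, Tendsto (A.errorProb μ) atTop (𝓝 0)

/-- `lim_n lim_T 𝔼_{π n}[ω_2(T)] = 1/2`, where the inner limits need not exist exactly: for every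
`ε > 0`, for all large `n`, for all `T` large enough (depending on `n`), the expected proportion is
within `ε` of `1/2`. -/
def EventuallyBalanced (A : Algorithm) (π : ℕ → Instance) : Prop :=
  ∀ ε : ℝ, 0 < ε → ∀ᶠ n in atTop, ∀ᶠ T in atTop, |A.expectedProportion (π n) 1 T - 1 / 2| < ε

/-- At every diagonal point `(a, a)`, the algorithm balances its pulls along some sequence of
instances approaching it with arm `0` the best, and along some such sequence with arm `1` the
best. -/
def IsStable (A : Algorithm) : Prop :=
  ∀ a ∈ Set.Ioo (0 : ℝ) 1,
    (∃ π : ℕ → Instance, (∀ n, (π n).mean 1 < (π n).mean 0) ∧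
      Tendsto (fun n => (π n).mean) atTop (𝓝 (fun _ => a)) ∧ A.EventuallyBalanced π) ∧
    (∃ π : ℕ → Instance, (∀ n, (π n).mean 0 < (π n).mean 1) ∧
      Tendsto (fun n => (π n).mean) atTop (𝓝 (fun _ => a)) ∧ A.EventuallyBalanced π)

/-- Uniform sampling: the arms are pulled in turn, and the arm with the highest empirical mean is
recommended (arm `0` in case of a tie). -/
noncomputable def uniformSampling : Algorithm where
  sample _ t _ := PMF.pure (if Even t then 0 else 1)
  recommend _ h := PMF.pure (if h.empMean 1 ≤ h.empMean 0 then 0 else 1)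

end Algorithm

/-- The Kullback-Leibler divergence between the Bernoulli laws of means `p` and `q`
(for `0 ≤ p ≤ 1` and `0 < q < 1`; the convention `0 log 0 = 0` holds automatically). -/
noncomputable def klBernoulli (p q : ℝ) : ℝ :=
  p * Real.log (p / q) + (1 - p) * Real.log ((1 - p) / (1 - q))

/-- `g(x, μ) = inf_{λ ∈ [0,1]} (1 - x) d(λ, μ₁) + x d(λ, μ₂)`. -/
noncomputable def g (x : ℝ) (μ : Instance) : ℝ :=
  ⨅ l : Set.Icc (0 : ℝ) 1,
    ((1 - x) * klBernoulli (l : ℝ) (μ.mean 0) + x * klBernoulli (l : ℝ) (μ.mean 1))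

end TwoArmBandit

/-! The upper bound is a change of measure. Let `ν` be an instance whose best arm is the worst arm
of `μ`. Consistency makes the algorithm recommend that arm under `ν` with probability tending to 1.
Moving this event to `μ` costs at most about `exp (-KL)`, where `KL` is the expected log-likelihood
ratio under `ν`, namely `T` times the average of `d(ν_k, μ_k)` weighted by the expected pull
proportions under `ν` (`pmfMean_logLikelihood`, `outputLaw_ge`). Stability supplies such `ν`
arbitrarily close to any `(a, a)`, on the side of the diagonal opposite to `μ`, with proportions
close to 1/2. So the exponent is at most `balancedDivergence μ a` for every `a`, and the infimum
over `a` is `g (1 / 2) μ`.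

Uniform sampling is itself consistent and stable, so the same bound applies to it and no separate
large-deviation lower bound on its error probability is needed. The reverse inequality is a Chernoff
bound: the error is at most a constant times `ρ ^ T`, where `ρ` is the Bhattacharyya coefficient of
the two arms (`exists_errorProb_uniformSampling_le`), while evaluating the objective at one point
gives `g (1 / 2) μ ≤ -log ρ` (`g_half_le_neg_log`). -/

namespace TwoArmBandit

/-! ### Expectations under probability mass functions on finite types -/

/-- The expectation of a real function under a probability mass function on a finite type. -/
noncomputable def pmfMean {α : Type*} [Fintype α] (p : PMF α) (F : α → ℝ) : ℝ :=
  ∑ a, (p a).toReal * F a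

section pmfMean

variable {α β : Type*} [Fintype α] [Fintype β]

lemma pmfMean_pure (a : α) (F : α → ℝ) : pmfMean (PMF.pure a) F = F a := by
  classical
  rw [pmfMean, Finset.sum_eq_single a]
  · simp
  · intro b _ hb
    simp [PMF.pure_apply, hb]
  · simp

lemma pmfMean_bind (p : PMF α) (q : α → PMF β) (F : β → ℝ) :
    pmfMean (p.bind q) F = pmfMean p fun a => pmfMean (q a) F := by
  have h : ∀ b, (p.bind q b).toReal = ∑ a, (p a).toReal * (q a b).toReal := fun b => by
    rw [PMF.bind_apply, tsum_fintype,
      ENNReal.toReal_sum fun a _ => ENNReal.mul_ne_top (p.apply_ne_top a) ((q a).apply_ne_top b)]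
    simp
  simp only [pmfMean, h, Finset.sum_mul, Finset.mul_sum]
  rw [Finset.sum_comm]
  simp only [mul_assoc]

lemma sum_toReal_pmf (p : PMF α) : ∑ a, (p a).toReal = 1 := by
  rw [← ENNReal.toReal_sum fun a _ => p.apply_ne_top a, ← tsum_fintype (L := .unconditional α),
    p.tsum_coe, ENNReal.toReal_one]

lemma pmfMean_const (p : PMF α) (c : ℝ) : pmfMean p (fun _ => c) = c := by
  rw [pmfMean, ← Finset.sum_mul, sum_toReal_pmf, one_mul]

/-- The comparison is asked only on the support, where the pull counts of uniform sampling are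
deterministic. -/
lemma pmfMean_mono {p : PMF α} {F G : α → ℝ} (h : ∀ a, p a ≠ 0 → F a ≤ G a) :
    pmfMean p F ≤ pmfMean p G := by
  refine Finset.sum_le_sum fun a _ => ?_
  by_cases ha : p a = 0
  · simp [ha]
  · exact mul_le_mul_of_nonneg_left (h a ha) ENNReal.toReal_nonneg

lemma pmfMean_add (p : PMF α) (F G : α → ℝ) :
    pmfMean p (fun a => F a + G a) = pmfMean p F + pmfMean p G := by
  simp [pmfMean, mul_add, Finset.sum_add_distrib]

lemma pmfMean_mul_const (p : PMF α) (F : α → ℝ) (c : ℝ) :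
    pmfMean p (fun a => F a * c) = pmfMean p F * c := by
  simp [pmfMean, Finset.sum_mul, mul_assoc]

end pmfMean

namespace Instance

lemma pmfMean_rewardLaw (μ : Instance) (k : Fin 2) (F : Bool → ℝ) :
    pmfMean (μ.rewardLaw k) F = μ.mean k * F true + (1 - μ.mean k) * F false := by
  have h := μ.mean_mem k
  simp [pmfMean, rewardLaw, ENNReal.toReal_ofReal h.1.le,
    ENNReal.toReal_ofReal (sub_nonneg.2 h.2.le)]

/-- The arm with the lowest mean. -/
noncomputable def worstArm (μ : Instance) : Fin 2 := if μ.mean 1 < μ.mean 0 then 1 else 0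

lemma ne_bestArm_iff (μ : Instance) (k : Fin 2) : k ≠ μ.bestArm ↔ k = μ.worstArm := by
  unfold bestArm worstArm
  split_ifs <;> fin_cases k <;> simp

lemma mean_worstArm_lt (μ : Instance) : μ.mean μ.worstArm < μ.mean μ.bestArm := by
  unfold bestArm worstArm
  split_ifs with h
  · exact h
  · exact lt_of_le_of_ne (not_lt.1 h) μ.mean_ne

/-- The probability of the reward `x.2` from arm `x.1`. -/
noncomputable def rewardProb (μ : Instance) (x : Fin 2 × Bool) : ℝ :=
  if x.2 then μ.mean x.1 else 1 - μ.mean x.1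

lemma rewardProb_pos (μ : Instance) (x : Fin 2 × Bool) : 0 < μ.rewardProb x := by
  have h := μ.mean_mem x.1
  unfold rewardProb
  split_ifs
  · exact h.1
  · linarith [h.2]

end Instance

/-! ### Expectations of functions of the history -/

namespace Algorithm

variable (A : Algorithm) (μ ν : Instance) (T : ℕ)

lemma pmfMean_historyLaw_zero (F : History 0 → ℝ) :
    pmfMean (A.historyLaw μ T 0) F = F Fin.elim0 :=
  pmfMean_pure _ _

lemma pmfMean_historyLaw_succ (t : ℕ) (F : History (t + 1) → ℝ) :
    pmfMean (A.historyLaw μ T (t + 1)) F =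
      pmfMean (A.historyLaw μ T t) fun h => pmfMean (A.sample T t h) fun k =>
        pmfMean (μ.rewardLaw k) fun b =>
          F (Fin.snoc (α := fun _ => Fin 2 × Bool) h (k, b)) := by
  simp only [historyLaw, pmfMean_bind, pmfMean_pure]

/-- Change of measure. -/
lemma pmfMean_historyLaw_change (t : ℕ) (F : History t → ℝ) :
    pmfMean (A.historyLaw μ T t) F =
      pmfMean (A.historyLaw ν T t) fun h => F h * ∏ s, (μ.rewardProb (h s) / ν.rewardProb (h s)) := by
  induction t with
  | zero => simp [pmfMean_historyLaw_zero]
  | succ t ih =>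
    rw [pmfMean_historyLaw_succ, pmfMean_historyLaw_succ, ih]
    -- The sampling law is the same under both instances, so only the reward of the last round has
    -- to be reweighted.
    congr 1
    funext h
    rw [← pmfMean_mul_const]
    congr 1
    funext k
    have h1 := (ν.rewardProb_pos (k, true)).ne'
    have h2 := (ν.rewardProb_pos (k, false)).ne'
    simp only [Instance.pmfMean_rewardLaw, Fin.prod_univ_castSucc, Fin.snoc_castSucc, Fin.snoc_last]
    simp only [Instance.rewardProb, if_true, Bool.false_eq_true, if_false] at h1 h2 ⊢
    field_simp

/-- A sum of reward-dependent terms has the same expectation as the sum of their conditional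
expectations given the pulled arms. -/
lemma pmfMean_sum_sub (t : ℕ) (f : Fin 2 × Bool → ℝ) :
    pmfMean (A.historyLaw μ T t)
      (fun h => ∑ s, (f (h s) - pmfMean (μ.rewardLaw (h s).1) fun b => f ((h s).1, b))) = 0 := by
  induction t with
  | zero => simp [pmfMean_historyLaw_zero]
  | succ t ih =>
    rw [pmfMean_historyLaw_succ, ← ih]
    congr 1
    funext h
    simp only [Fin.sum_univ_castSucc, Fin.snoc_castSucc, Fin.snoc_last]
    refine Eq.trans ?_ (pmfMean_const (A.sample T t h) _)
    congr 1
    funext k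
    simp only [Instance.pmfMean_rewardLaw]
    ring

lemma sum_arm_eq {t : ℕ} (h : History t) (D : Fin 2 → ℝ) :
    ∑ s, D (h s).1 = (t - h.pulls 1) * D 0 + h.pulls 1 * D 1 := by
  have h1 : ∀ s, D (h s).1 = D 0 + (if (h s).1 = 1 then D 1 - D 0 else 0) := fun s => by
    generalize (h s).1 = k; fin_cases k <;> simp
  simp only [h1, Finset.sum_add_distrib, ← Finset.sum_filter, Finset.sum_const, Finset.card_univ,
    Fintype.card_fin, nsmul_eq_mul, History.pulls]
  ring

lemma pmfMean_rewardLaw_log (k : Fin 2) :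
    (pmfMean (ν.rewardLaw k) fun b =>
      Real.log (ν.rewardProb (k, b) / μ.rewardProb (k, b))) =
      klBernoulli (ν.mean k) (μ.mean k) := by
  simp [Instance.pmfMean_rewardLaw, Instance.rewardProb, klBernoulli]

/-- The expected log-likelihood ratio of the whole history. -/
lemma pmfMean_logLikelihood (hT : T ≠ 0) :
    pmfMean (A.historyLaw ν T T)
      (fun h => ∑ s, Real.log (ν.rewardProb (h s) / μ.rewardProb (h s))) =
      T * ((1 - A.expectedProportion ν 1 T) * klBernoulli (ν.mean 0) (μ.mean 0) +
        A.expectedProportion ν 1 T * klBernoulli (ν.mean 1) (μ.mean 1)) := by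
  have h0 : (T : ℝ) ≠ 0 := Nat.cast_ne_zero.2 hT
  have h := A.pmfMean_sum_sub ν T T fun x => Real.log (ν.rewardProb x / μ.rewardProb x)
  simp only [pmfMean_rewardLaw_log, Finset.sum_sub_distrib] at h
  have h2 : pmfMean (A.historyLaw ν T T)
      (fun h => ∑ s, klBernoulli (ν.mean (h s).1) (μ.mean (h s).1)) =
      T * ((1 - A.expectedProportion ν 1 T) * klBernoulli (ν.mean 0) (μ.mean 0) +
        A.expectedProportion ν 1 T * klBernoulli (ν.mean 1) (μ.mean 1)) := by
    have h3 : A.expectedProportion ν 1 T =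
        pmfMean (A.historyLaw ν T T) fun h => (h.pulls 1 : ℝ) / T := rfl
    have h4 : ∀ h : History T, ∑ s, klBernoulli (ν.mean (h s).1) (μ.mean (h s).1) =
        T * klBernoulli (ν.mean 0) (μ.mean 0) + (h.pulls 1 : ℝ) / T *
          (T * (klBernoulli (ν.mean 1) (μ.mean 1) - klBernoulli (ν.mean 0) (μ.mean 0))) := by
      intro h
      rw [sum_arm_eq h fun k => klBernoulli (ν.mean k) (μ.mean k)]
      field_simp
      ring
    simp only [h4]
    rw [pmfMean_add, pmfMean_const, pmfMean_mul_const, h3]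
    ring
  rw [← h2, ← sub_eq_zero, ← h]
  simp [pmfMean, mul_sub, Finset.sum_sub_distrib]

/-! ### Error probabilities -/

lemma errorProb_eq : A.errorProb μ T = A.outputLaw μ T μ.worstArm := by
  have : {k | k ≠ μ.bestArm} = {μ.worstArm} := by
    ext k
    simpa using μ.ne_bestArm_iff k
  rw [errorProb, this, PMF.toMeasure_apply_singleton _ _ (measurableSet_singleton _)]

lemma errorProb_ne_top : A.errorProb μ T ≠ ∞ := by
  rw [errorProb_eq]
  exact PMF.apply_ne_top _ _

lemma toReal_outputLaw (j : Fin 2) :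
    (A.outputLaw μ T j).toReal =
      pmfMean (A.historyLaw μ T T) fun h => (A.recommend T h j).toReal := by
  have h := pmfMean_bind (A.historyLaw μ T T) (A.recommend T) (fun k => if k = j then 1 else 0)
  simpa [pmfMean, outputLaw] using h

lemma errorRate_eq {p : ℝ} (hp : 0 < p) (h : (A.errorProb μ T).toReal = p) :
    A.errorRate μ T = ((-Real.log p / T : ℝ) : EReal) := by
  rw [errorRate, ← ENNReal.ofReal_toReal (A.errorProb_ne_top μ T), h, ENNReal.log_ofReal_of_pos hp]
  simp [EReal.coe_div]

/-- If the output is `j` with probability `q` under `ν`, then under `μ` it is `j` with probability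
at least `q * exp (-(KL + 1) / q)`. -/
lemma outputLaw_ge (hT : T ≠ 0) (j : Fin 2) {q : ℝ} (hq : (A.outputLaw ν T j).toReal = q)
    (hq0 : 0 < q) :
    q * Real.exp (-((T * ((1 - A.expectedProportion ν 1 T) *
      klBernoulli (ν.mean 0) (μ.mean 0) + A.expectedProportion ν 1 T *
        klBernoulli (ν.mean 1) (μ.mean 1)) + 1) / q)) ≤ (A.outputLaw μ T j).toReal := by
  rw [← A.pmfMean_logLikelihood μ ν T hT]
  set L : History T → ℝ := fun h => ∑ s, Real.log (ν.rewardProb (h s) / μ.rewardProb (h s))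
  have hL : ∀ h : History T, ∏ s, (μ.rewardProb (h s) / ν.rewardProb (h s)) = Real.exp (-L h) := by
    intro h
    rw [← Finset.sum_neg_distrib, Real.exp_sum]
    refine Finset.prod_congr rfl fun s _ => ?_
    rw [← Real.log_inv, inv_div,
      Real.exp_log (div_pos (μ.rewardProb_pos _) (ν.rewardProb_pos _))]
  set K := pmfMean (A.historyLaw ν T T) L with hK
  set c := (K + 1) / q with hc
  rw [toReal_outputLaw] at hq ⊢
  rw [A.pmfMean_historyLaw_change μ ν T T]
  simp only [hL]
  -- A pointwise substitute for the data-processing inequality. With `r` the recommendation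
  -- probability, the tangent of `exp` at `-c` bounds `r * exp (-L)` below by `exp (-c) * r * (1 + c
  -- - L)`, and `-L * (1 - r) ≤ exp (-L)` replaces `r * L` by `L + exp (-L)`. In expectation this
  -- reads `exp (-c) * (q * (1 + c) - K - 1)`, which is `q * exp (-c)` because `c` was chosen with
  -- `q * c = K + 1`.
  have hpt : ∀ h : History T, A.historyLaw ν T T h ≠ 0 →
      ((A.recommend T h j).toReal * (1 + c) * Real.exp (-c) + L h * (-Real.exp (-c))) +
        Real.exp (-L h) * (-Real.exp (-c)) ≤
      (A.recommend T h j).toReal * Real.exp (-L h) := by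
    intro h _
    set r := (A.recommend T h j).toReal
    have hr0 : 0 ≤ r := ENNReal.toReal_nonneg
    have hr1 : r ≤ 1 := ENNReal.toReal_mono ENNReal.one_ne_top (PMF.coe_le_one _ _)
    have e1 : c - L h + 1 ≤ Real.exp (c - L h) := Real.add_one_le_exp _
    have e2 : -L h + 1 ≤ Real.exp (-L h) := Real.add_one_le_exp _
    have e3 : Real.exp (-L h) = Real.exp (-c) * Real.exp (c - L h) := by
      rw [← Real.exp_add]; ring_nf
    have hE := Real.exp_pos (-c)
    have k1 : r * (Real.exp (-c) * (c - L h + 1)) ≤ r * Real.exp (-L h) := by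
      rw [e3]; gcongr
    have k2 : -L h * (1 - r) * Real.exp (-c) ≤ Real.exp (-L h) * Real.exp (-c) := by
      gcongr
      have : -L h * (1 - r) ≤ Real.exp (-L h) * (1 - r) := by
        (gcongr; linarith)
      have := Real.exp_pos (-L h)
      nlinarith
    nlinarith
  have hone : pmfMean (A.historyLaw ν T T) (fun h => Real.exp (-L h)) = 1 := by
    have h := A.pmfMean_historyLaw_change μ ν T T fun _ => 1
    simpa only [hL, one_mul, pmfMean_const, eq_comm] using h
  have := pmfMean_mono hpt
  simp only [pmfMean_add, pmfMean_mul_const, hq, hone, ← hK] at this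
  refine le_trans (le_of_eq ?_) this
  have hKc : K = c * q - 1 := by rw [hc]; field_simp; ring
  rw [hKc]
  ring

end Algorithm

/-! ### The upper bound on the error exponent -/

namespace Algorithm

variable {A : Algorithm} {μ ν : Instance}

lemma tendsto_outputLaw_bestArm (hcons : A.IsConsistent) (ν : Instance) :
    Tendsto (fun T => (A.outputLaw ν T ν.bestArm).toReal) atTop (𝓝 1) := by
  have h1 : ∀ T, (A.outputLaw ν T ν.bestArm).toReal = 1 - (A.errorProb ν T).toReal := fun T => by
    have h := sum_toReal_pmf (A.outputLaw ν T)
    rw [Fin.sum_univ_two] at h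
    rw [errorProb_eq, ← h]
    unfold Instance.bestArm Instance.worstArm
    split_ifs <;> ring
  have h2 : Tendsto (fun T => (A.errorProb ν T).toReal) atTop (𝓝 0) :=
    (ENNReal.tendsto_toReal ENNReal.zero_ne_top).comp (hcons ν)
  simpa only [h1, sub_zero] using h2.const_sub 1

/-- Recommending the best arm of `ν` is an error under `μ`. Since its probability `q T` under `ν`
tends to 1, the corrections in `outputLaw_ge` vanish after taking logarithms and dividing by `T`. -/
lemma eventually_errorRate_le (hcons : A.IsConsistent) (hνμ : ν.bestArm = μ.worstArm) {C C' : ℝ}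
    (hC : ∀ᶠ T in atTop, (1 - A.expectedProportion ν 1 T) * klBernoulli (ν.mean 0) (μ.mean 0) +
      A.expectedProportion ν 1 T * klBernoulli (ν.mean 1) (μ.mean 1) ≤ C) (hCC : C < C') :
    ∀ᶠ T in atTop, A.errorRate μ T ≤ (C' : EReal) := by
  set q : ℕ → ℝ := fun T => (A.outputLaw ν T ν.bestArm).toReal with hq
  have hq1 : Tendsto q atTop (𝓝 1) := tendsto_outputLaw_bestArm hcons ν
  have hinv : Tendsto (fun T : ℕ => (T : ℝ)⁻¹) atTop (𝓝 0) := tendsto_inv_atTop_nhds_zero_nat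
  have hlim : Tendsto (fun T : ℕ => -Real.log (q T) * (T : ℝ)⁻¹ + (C + (T : ℝ)⁻¹) / q T) atTop
      (𝓝 C) := by
    have h := ((hq1.log one_ne_zero).neg.mul hinv).add ((hinv.const_add C).div hq1 one_ne_zero)
    simpa using h
  filter_upwards [hC, hlim.eventually_lt_const hCC, hq1.eventually_const_lt zero_lt_one,
    eventually_ne_atTop 0] with T hX hlt hq0 hT
  have hge := A.outputLaw_ge μ ν T hT ν.bestArm rfl hq0
  set X := (1 - A.expectedProportion ν 1 T) * klBernoulli (ν.mean 0) (μ.mean 0) +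
    A.expectedProportion ν 1 T * klBernoulli (ν.mean 1) (μ.mean 1)
  change q T * Real.exp (-((T * X + 1) / q T)) ≤ _ at hge
  have hT0 : (0 : ℝ) < T := Nat.cast_pos.2 (Nat.pos_of_ne_zero hT)
  have hpos : 0 < q T * Real.exp (-((T * X + 1) / q T)) := mul_pos hq0 (Real.exp_pos _)
  have hp := hpos.trans_le hge
  rw [A.errorRate_eq μ T hp (by rw [errorProb_eq, hνμ]), EReal.coe_le_coe_iff]
  refine le_trans ?_ hlt.le
  have hlog := Real.log_le_log hpos hge
  rw [Real.log_mul hq0.ne' (Real.exp_ne_zero _), Real.log_exp] at hlog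
  calc -Real.log (A.outputLaw μ T ν.bestArm).toReal / T
      ≤ (-Real.log (q T) + (T * X + 1) / q T) / T := by gcongr; linarith
    _ = -Real.log (q T) * (T : ℝ)⁻¹ + (X + (T : ℝ)⁻¹) / q T := by field_simp
    _ ≤ _ := by gcongr

end Algorithm

/-! ### Continuity of the divergence and passage to the diagonal -/

lemma continuous_klBernoulli_left {q : ℝ} (hq : q ∈ Set.Ioo (0 : ℝ) 1) :
    Continuous fun p => klBernoulli p q := by
  have h0 : q ≠ 0 := hq.1.ne'
  have h1 : 1 - q ≠ 0 := (sub_pos.2 hq.2).ne'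
  have key : ∀ c : ℝ, c ≠ 0 → ∀ x : ℝ, x * Real.log (x / c) = x * Real.log x - x * Real.log c := by
    intro c hc x
    rcases eq_or_ne x 0 with rfl | hx
    · simp
    · rw [Real.log_div hx hc]; ring
  have h : (fun p => klBernoulli p q) = fun p => (p * Real.log p - p * Real.log q) +
      ((1 - p) * Real.log (1 - p) - (1 - p) * Real.log (1 - q)) := by
    funext p
    rw [klBernoulli, key q h0, key (1 - q) h1]
  rw [h]
  have h2 : Continuous fun p : ℝ => (1 - p) * Real.log (1 - p) :=
    Real.continuous_mul_log.comp (continuous_const.sub continuous_id)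
  have h3 := Real.continuous_mul_log
  fun_prop

/-- The objective function whose infimum is `g (1 / 2) μ`. -/
noncomputable def balancedDivergence (μ : Instance) (l : ℝ) : ℝ :=
  (1 - 1 / 2) * klBernoulli l (μ.mean 0) + 1 / 2 * klBernoulli l (μ.mean 1)

lemma continuous_balancedDivergence (μ : Instance) : Continuous (balancedDivergence μ) :=
  ((continuous_klBernoulli_left (μ.mean_mem 0)).const_mul _).add
    ((continuous_klBernoulli_left (μ.mean_mem 1)).const_mul _)

lemma g_le_balancedDivergence (μ : Instance) {l : ℝ} (hl : l ∈ Set.Icc (0 : ℝ) 1) :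
    g (1 / 2) μ ≤ balancedDivergence μ l := by
  have hb : BddBelow (Set.range fun l : Set.Icc (0 : ℝ) 1 => balancedDivergence μ l) := by
    have := (isCompact_Icc (a := (0 : ℝ)) (b := 1)).bddBelow_image
      (continuous_balancedDivergence μ).continuousOn
    rwa [Set.image_eq_range] at this
  exact ciInf_le hb ⟨l, hl⟩

namespace Algorithm

variable {A : Algorithm}

lemma eventually_errorRate_le_of_tendsto (hcons : A.IsConsistent) {μ : Instance} {a : ℝ}
    {π : ℕ → Instance} (hbest : ∀ n, (π n).bestArm = μ.worstArm)
    (hlim : Tendsto (fun n => (π n).mean) atTop (𝓝 fun _ => a)) (hbal : A.EventuallyBalanced π)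
    {C : ℝ} (hC : balancedDivergence μ a < C) :
    ∀ᶠ T in atTop, A.errorRate μ T ≤ (C : EReal) := by
  obtain ⟨C', hC1, hC2⟩ := exists_between hC
  have hk : ∀ k, Tendsto (fun n => klBernoulli ((π n).mean k) (μ.mean k)) atTop
      (𝓝 (klBernoulli a (μ.mean k))) := fun k =>
    ((continuous_klBernoulli_left (μ.mean_mem k)).tendsto a).comp (tendsto_pi_nhds.1 hlim k)
  have hcont : Tendsto (fun z : ℝ × ℝ × ℝ => (1 - z.1) * z.2.1 + z.1 * z.2.2)
      (𝓝 (1 / 2, klBernoulli a (μ.mean 0), klBernoulli a (μ.mean 1)))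
      (𝓝 (balancedDivergence μ a)) := by
    have : Continuous fun z : ℝ × ℝ × ℝ => (1 - z.1) * z.2.1 + z.1 * z.2.2 := by fun_prop
    exact this.tendsto _
  -- Splitting the neighbourhood into a product yields an `ε` for the proportion that does not
  -- depend on `n`, as `EventuallyBalanced` requires; then one `n` is fixed before `T` grows.
  have hev := hcont.eventually_lt_const hC1
  rw [nhds_prod_eq, eventually_prod_iff] at hev
  obtain ⟨pa, hpa, pb, hpb, hp⟩ := hev
  obtain ⟨ε, hε, hball⟩ := Metric.eventually_nhds_iff.1 hpa
  obtain ⟨n, hn1, hn2⟩ := ((hbal ε hε).and (((hk 0).prodMk_nhds (hk 1)).eventually hpb)).exists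
  refine eventually_errorRate_le hcons (hbest n) (C := C') ?_ hC2
  filter_upwards [hn1] with T hT
  exact (hp (hball (by rwa [Real.dist_eq])) hn2).le

theorem limsup_errorRate_le (hcons : A.IsConsistent) (hstab : A.IsStable) (μ : Instance) :
    limsup (A.errorRate μ) atTop ≤ (g (1 / 2) μ : EReal) := by
  have h1 : ∀ a ∈ Set.Ioo (0 : ℝ) 1, limsup (A.errorRate μ) atTop ≤ balancedDivergence μ a := by
    intro a ha
    refine EReal.le_of_forall_lt_iff_le.1 fun C hC => ?_
    refine limsup_le_of_le (h := ?_)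
    rw [EReal.coe_lt_coe_iff] at hC
    obtain ⟨⟨π, hπ, hlim, hbal⟩, ⟨π', hπ', hlim', hbal'⟩⟩ := hstab a ha
    by_cases h : μ.mean 1 < μ.mean 0
    · refine eventually_errorRate_le_of_tendsto hcons (fun n => ?_) hlim' hbal' hC
      rw [Instance.bestArm, if_neg (hπ' n).not_gt, Instance.worstArm, if_pos h]
    · refine eventually_errorRate_le_of_tendsto hcons (fun n => ?_) hlim hbal hC
      rw [Instance.bestArm, if_pos (hπ n), Instance.worstArm, if_neg h]
  -- Stability speaks of interior points only, whereas the infimum in `g` includes 0 and 1.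
  have h2 : ∀ a ∈ Set.Icc (0 : ℝ) 1, limsup (A.errorRate μ) atTop ≤ balancedDivergence μ a := by
    rw [← closure_Ioo zero_ne_one]
    exact le_on_closure h1 continuousOn_const
      (continuous_coe_real_ereal.comp (continuous_balancedDivergence μ)).continuousOn
  refine EReal.le_of_forall_lt_iff_le.1 fun C hC => ?_
  rw [EReal.coe_lt_coe_iff] at hC
  obtain ⟨l, hl⟩ := exists_lt_of_ciInf_lt hC
  exact (h2 l l.2).trans (EReal.coe_le_coe_iff.2 hl.le)

end Algorithm

/-! ### The Chernoff bound for uniform sampling -/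

/-- The Bhattacharyya coefficient of the Bernoulli laws of means `a` and `b`. -/
noncomputable def bhattacharyya (a b : ℝ) : ℝ := √(a * b) + √((1 - a) * (1 - b))

lemma bhattacharyya_comm (a b : ℝ) : bhattacharyya a b = bhattacharyya b a := by
  rw [bhattacharyya, bhattacharyya, mul_comm a, mul_comm (1 - a)]

lemma bhattacharyya_pos {a b : ℝ} (ha : a ∈ Set.Ioo (0 : ℝ) 1) (hb : b ∈ Set.Ioo (0 : ℝ) 1) :
    0 < bhattacharyya a b :=
  add_pos_of_pos_of_nonneg (Real.sqrt_pos.2 (mul_pos ha.1 hb.1)) (Real.sqrt_nonneg _)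

lemma bhattacharyya_lt_one {a b : ℝ} (ha : a ∈ Set.Ioo (0 : ℝ) 1) (hb : b ∈ Set.Ioo (0 : ℝ) 1)
    (hab : a ≠ b) : bhattacharyya a b < 1 := by
  have h := sq_pos_of_ne_zero (sub_ne_zero.2 hab)
  have h1 : √(a * b) < (a + b) / 2 := by
    rw [Real.sqrt_lt' (by linarith [ha.1, hb.1])]; nlinarith
  have h2 : √((1 - a) * (1 - b)) < (1 - a + (1 - b)) / 2 := by
    rw [Real.sqrt_lt' (by linarith [ha.2, hb.2])]; nlinarith
  unfold bhattacharyya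
  linarith

/-- The exponential tilt at which the Chernoff bound is optimal. -/
lemma exists_tilt {a b : ℝ} (hb : 0 < b) (hba : b < a) (ha : a < 1) :
    ∃ z : ℝ, 1 ≤ z ∧ (1 - b + b * z) * (1 - a + a * z⁻¹) = bhattacharyya a b ^ 2 := by
  have ha0 : 0 < a := hb.trans hba
  have ha1 : 0 < 1 - a := by linarith
  have hb1 : 0 < 1 - b := by linarith
  have hs : 0 < √(a * b) := Real.sqrt_pos.2 (mul_pos ha0 hb)
  have hs' : 0 < √((1 - a) * (1 - b)) := Real.sqrt_pos.2 (mul_pos ha1 hb1)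
  have hsq : √(a * b) ^ 2 = a * b := Real.sq_sqrt (mul_pos ha0 hb).le
  have hsq' : √((1 - a) * (1 - b)) ^ 2 = (1 - a) * (1 - b) := Real.sq_sqrt (mul_pos ha1 hb1).le
  unfold bhattacharyya
  set s := √(a * b)
  set s' := √((1 - a) * (1 - b))
  have hss : 0 < s * s' := mul_pos hs hs'
  have hprod : (s * s') ^ 2 = (a * (1 - b)) * (b * (1 - a)) := by
    rw [mul_pow, hsq, hsq']; ring
  -- This is `√(a (1 - b) / (b (1 - a)))`, which makes the two `z`-dependent terms of the expanded
  -- product, `b (1 - a) z` and `a (1 - b) / z`, both equal to `s * s'`. The total is then `(s + s')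
  -- ^ 2`.
  refine ⟨a * (1 - b) / (s * s'), ?_, ?_⟩
  · rw [one_le_div hss]
    refine le_of_sq_le_sq ?_ (mul_pos ha0 hb1).le
    rw [hprod, sq]
    gcongr
  · have h1 : b * (a * (1 - b) / (s * s')) * (1 - a) = s * s' := by
      field_simp
      nlinarith
    have h2 : a * (a * (1 - b) / (s * s'))⁻¹ * (1 - b) = s * s' := by
      field_simp
    have h3 : (a * (1 - b) / (s * s')) * (a * (1 - b) / (s * s'))⁻¹ = 1 :=
      mul_inv_cancel₀ (div_pos (mul_pos ha0 hb1) hss).ne'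
    linear_combination h1 + h2 + a * b * h3 - hsq - hsq'

/-- The point is the mean of the normalized geometric mean of the two reward laws. Against it, the
averaged log-ratio equals `-log ρ` for both outcomes. -/
lemma balancedDivergence_eq_neg_log (μ : Instance) :
    balancedDivergence μ (√(μ.mean 0 * μ.mean 1) / bhattacharyya (μ.mean 0) (μ.mean 1)) =
      -Real.log (bhattacharyya (μ.mean 0) (μ.mean 1)) := by
  have hρ := bhattacharyya_pos (μ.mean_mem 0) (μ.mean_mem 1)
  obtain ⟨⟨ha, ha1⟩, ⟨hb, hb1⟩⟩ := And.intro (μ.mean_mem 0) (μ.mean_mem 1)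
  unfold balancedDivergence klBernoulli
  generalize μ.mean 0 = a at *
  generalize μ.mean 1 = b at *
  have ha' := sub_pos.2 ha1
  have hb' := sub_pos.2 hb1
  have hs : 0 < √(a * b) := Real.sqrt_pos.2 (mul_pos ha hb)
  have hs' : 0 < √((1 - a) * (1 - b)) := Real.sqrt_pos.2 (mul_pos ha' hb')
  have hc : 1 - √(a * b) / bhattacharyya a b = √((1 - a) * (1 - b)) / bhattacharyya a b := by
    rw [eq_div_iff hρ.ne', sub_mul, div_mul_cancel₀ _ hρ.ne', bhattacharyya]; ring
  have hl := div_pos hs hρ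
  have hl' := div_pos hs' hρ
  rw [hc, Real.log_div hl.ne' ha.ne', Real.log_div hl.ne' hb.ne', Real.log_div hl'.ne' ha'.ne',
    Real.log_div hl'.ne' hb'.ne', Real.log_div hs.ne' hρ.ne', Real.log_div hs'.ne' hρ.ne',
    Real.log_sqrt (mul_pos ha hb).le, Real.log_sqrt (mul_pos ha' hb').le,
    Real.log_mul ha.ne' hb.ne', Real.log_mul ha'.ne' hb'.ne', ← hc]
  ring

lemma g_half_le_neg_log (μ : Instance) :
    g (1 / 2) μ ≤ -Real.log (bhattacharyya (μ.mean 0) (μ.mean 1)) := by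
  rw [← balancedDivergence_eq_neg_log]
  have hρ := bhattacharyya_pos (μ.mean_mem 0) (μ.mean_mem 1)
  refine g_le_balancedDivergence μ ⟨div_nonneg (Real.sqrt_nonneg _) hρ.le, ?_⟩
  rw [div_le_one hρ]
  exact le_add_of_nonneg_right (Real.sqrt_nonneg _)

/-! ### Pull counts, rewards and exponential moments under uniform sampling -/

namespace History

lemma pulls_snoc {t : ℕ} (h : History t) (x : Fin 2 × Bool) (k : Fin 2) :
    pulls (Fin.snoc (α := fun _ => Fin 2 × Bool) h x) k = h.pulls k + if x.1 = k then 1 else 0 := by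
  simp only [pulls, Finset.card_filter, Fin.sum_univ_castSucc, Fin.snoc_castSucc, Fin.snoc_last]

lemma reward_le_pulls {t : ℕ} (h : History t) (k : Fin 2) : h.reward k ≤ h.pulls k :=
  Finset.card_le_card fun s hs => by
    simp only [Finset.mem_filter, Finset.mem_univ, true_and] at hs ⊢
    rw [hs]

lemma prod_pow_reward {t : ℕ} (h : History t) (k : Fin 2) (z : ℝ) :
    ∏ s, (if h s = (k, true) then z else 1) = z ^ h.reward k := by
  rw [Finset.prod_ite, Finset.prod_const, Finset.prod_const_one, mul_one, reward]

end History

namespace Algorithm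

variable (μ : Instance)

/-- The arm pulled by uniform sampling after `t` rounds. -/
def turn (t : ℕ) : Fin 2 := if Even t then 0 else 1

lemma uniformSampling_pulls (T : ℕ) : ∀ (t : ℕ) (h : History t),
    uniformSampling.historyLaw μ T t h ≠ 0 → h.pulls 0 = (t + 1) / 2 ∧ h.pulls 1 = t / 2
  | 0, h, _ => by simp [History.pulls]
  | t + 1, h, hh => by
    rw [← PMF.mem_support_iff, historyLaw, PMF.mem_support_bind_iff] at hh
    obtain ⟨h', hh', hh⟩ := hh
    obtain ⟨k, hk, hh⟩ := (PMF.mem_support_bind_iff _ _ _).1 hh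
    obtain ⟨b, -, hh⟩ := (PMF.mem_support_bind_iff _ _ _).1 hh
    rw [PMF.mem_support_pure_iff] at hh
    have hk : k = turn t := (PMF.mem_support_pure_iff _ _).1 hk
    obtain ⟨h0, h1⟩ := uniformSampling_pulls T t h' ((PMF.mem_support_iff _ _).1 hh')
    rw [hh, History.pulls_snoc, History.pulls_snoc, h0, h1, hk, turn]
    rcases Nat.even_or_odd' t with ⟨m, rfl | rfl⟩
    · simp; omega
    · simp; omega

/-- The arms are pulled in a deterministic order, so the rewards are independent and the expectation
factorizes. -/
lemma uniformSampling_mean_prod (T t : ℕ) (f : Fin 2 × Bool → ℝ) :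
    pmfMean (uniformSampling.historyLaw μ T t) (fun h => ∏ s, f (h s)) =
      ∏ s ∈ Finset.range t, pmfMean (μ.rewardLaw (turn s)) fun b => f (turn s, b) := by
  induction t with
  | zero => simp [pmfMean_historyLaw_zero]
  | succ t ih =>
    rw [pmfMean_historyLaw_succ, Finset.prod_range_succ, ← ih, ← pmfMean_mul_const]
    congr 1
    funext h
    refine (pmfMean_pure (turn t) _).trans ?_
    simp only [Fin.prod_univ_castSucc, Fin.snoc_castSucc, Fin.snoc_last,
      Instance.pmfMean_rewardLaw]
    ring

/-- The pull counts differ by at most one and a reward never exceeds its pull count, so comparing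
empirical means amounts to comparing cumulated rewards, with at most one unit of slack. Both arms
have been pulled once `2 ≤ T`, which excludes division by zero. -/
lemma reward_le_of_recommend_worstArm {T : ℕ} (hT : 2 ≤ T) {h : History T}
    (hh : uniformSampling.historyLaw μ T T h ≠ 0)
    (hrec : uniformSampling.recommend T h μ.worstArm ≠ 0) :
    h.reward μ.bestArm ≤ h.reward μ.worstArm + 1 := by
  have hrec : μ.worstArm = if h.empMean 1 ≤ h.empMean 0 then 0 else 1 :=
    (PMF.mem_support_pure_iff _ _).1 hrec
  obtain ⟨h0, h1⟩ := uniformSampling_pulls μ T T h hh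
  have hp0 : 0 < h.pulls 0 := by omega
  have hp1 : 0 < h.pulls 1 := by omega
  have hle : h.pulls 1 ≤ h.pulls 0 := by omega
  have hle' : h.pulls 0 ≤ h.pulls 1 + 1 := by omega
  have hr1 := h.reward_le_pulls 1
  have hp0' : (0 : ℝ) < h.pulls 0 := Nat.cast_pos.2 hp0
  have hp1' : (0 : ℝ) < h.pulls 1 := Nat.cast_pos.2 hp1
  have hiff : h.empMean 1 ≤ h.empMean 0 ↔
      h.reward 1 * h.pulls 0 ≤ h.reward 0 * h.pulls 1 := by
    rw [History.empMean, History.empMean, div_le_div_iff₀ hp1' hp0']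
    exact_mod_cast Iff.rfl
  simp only [hiff] at hrec
  unfold Instance.bestArm
  unfold Instance.worstArm at hrec ⊢
  split_ifs at hrec ⊢ with hμ hemp hemp
  · simp at hrec
  · by_contra! hlt
    nlinarith
  · by_contra! hlt
    nlinarith
  · simp at hrec

/-- Exponential decay of the error probability of uniform sampling. -/
lemma exists_errorProb_uniformSampling_le : ∃ C : ℝ, 0 < C ∧ ∀ T, 2 ≤ T →
    (uniformSampling.errorProb μ T).toReal ≤
      C * bhattacharyya (μ.mean 0) (μ.mean 1) ^ T := by
  have hρ := bhattacharyya_pos (μ.mean_mem 0) (μ.mean_mem 1)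
  obtain ⟨z, hz, hzρ⟩ := exists_tilt (μ.mean_mem μ.worstArm).1 μ.mean_worstArm_lt
    (μ.mean_mem μ.bestArm).2
  have hz0 : 0 < z := zero_lt_one.trans_le hz
  -- The product of `f` over the rounds is `z` to the power (worst arm's reward minus best arm's
  -- reward).
  let f : Fin 2 × Bool → ℝ := fun x =>
    (if x = (μ.worstArm, true) then z else 1) * (if x = (μ.bestArm, true) then z⁻¹ else 1)
  let φ : Fin 2 → ℝ := fun k => pmfMean (μ.rewardLaw k) fun b => f (k, b)
  have hφ : φ 0 * φ 1 = bhattacharyya (μ.mean 0) (μ.mean 1) ^ 2 := by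
    simp only [φ, f, Instance.pmfMean_rewardLaw]
    by_cases hμ : μ.mean 1 < μ.mean 0
    · have hw : μ.worstArm = 1 := if_pos hμ
      have hb : μ.bestArm = 0 := if_pos hμ
      rw [hw, hb] at hzρ ⊢
      rw [← hzρ]
      simp
      ring
    · have hw : μ.worstArm = 0 := if_neg hμ
      have hb : μ.bestArm = 1 := if_neg hμ
      rw [hw, hb] at hzρ ⊢
      rw [bhattacharyya_comm, ← hzρ]
      simp
      ring
  have hφ0 : 0 ≤ φ 0 := by
    refine (pmfMean_const _ 0).symm.le.trans (pmfMean_mono fun b _ => ?_)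
    simp only [f]
    split_ifs <;> positivity
  set ρ := bhattacharyya (μ.mean 0) (μ.mean 1)
  -- Two consecutive rounds contribute `ρ ^ 2`; the constant absorbs the unpaired factor `φ 0` when
  -- `T` is odd.
  have hprod : ∀ T, ∏ s ∈ Finset.range T, φ (turn s) ≤ (1 + φ 0 / ρ) * ρ ^ T := by
    intro T
    have hC : 0 ≤ φ 0 / ρ := div_nonneg hφ0 hρ.le
    induction T using Nat.twoStepInduction with
    | zero => simpa using hC
    | one =>
      have : (1 + φ 0 / ρ) * ρ = ρ + φ 0 := by field_simp
      simp [turn, this, hρ.le]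
    | more T ih _ =>
      have hturn : φ (turn T) * φ (turn (T + 1)) = ρ ^ 2 := by
        rw [← hφ]
        rcases Nat.even_or_odd' T with ⟨m, rfl | rfl⟩
        · simp [turn]
        · have : 2 * m + 1 + 1 = 2 * (m + 1) := by ring
          simp [turn, this, mul_comm (φ 0)]
      rw [Finset.prod_range_succ, Finset.prod_range_succ, mul_assoc, hturn, pow_add, ← mul_assoc]
      gcongr
  refine ⟨z * (1 + φ 0 / ρ), by positivity, fun T hT => ?_⟩
  rw [errorProb_eq, toReal_outputLaw]
  -- Exponential Markov inequality: on an error the integrand on the right is at least 1, the extra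
  -- `z` paying for the unit of slack in the reward comparison.
  calc _ ≤ pmfMean (uniformSampling.historyLaw μ T T) (fun h => (∏ s, f (h s)) * z) := by
        refine pmfMean_mono fun h hh => ?_
        simp only [f, Finset.prod_mul_distrib, History.prod_pow_reward]
        by_cases hrec : uniformSampling.recommend T h μ.worstArm = 0
        · rw [hrec, ENNReal.toReal_zero]; positivity
        · refine (ENNReal.toReal_mono ENNReal.one_ne_top (PMF.coe_le_one _ _)).trans ?_
          have := pow_le_pow_right₀ hz (reward_le_of_recommend_worstArm μ hT hh hrec)
          rw [ENNReal.toReal_one, inv_pow, mul_right_comm, ← pow_succ, ← div_eq_mul_inv,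
            one_le_div (by positivity)]
          exact this
    _ = (∏ s ∈ Finset.range T, φ (turn s)) * z := by
        rw [pmfMean_mul_const, uniformSampling_mean_prod]
    _ ≤ (1 + φ 0 / ρ) * ρ ^ T * z := by gcongr; exact hprod T
    _ = _ := by ring

/-! ### Consistency, stability and exponent of uniform sampling -/

lemma uniformSampling_isConsistent : uniformSampling.IsConsistent := by
  intro μ
  obtain ⟨C, hC, h⟩ := exists_errorProb_uniformSampling_le μ
  have hlim : Tendsto (fun T => C * bhattacharyya (μ.mean 0) (μ.mean 1) ^ T) atTop (𝓝 0) := by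
    simpa using (tendsto_pow_atTop_nhds_zero_of_lt_one
      (bhattacharyya_pos (μ.mean_mem 0) (μ.mean_mem 1)).le
      (bhattacharyya_lt_one (μ.mean_mem 0) (μ.mean_mem 1) μ.mean_ne)).const_mul C
  rw [← ENNReal.tendsto_toReal_iff (fun T => errorProb_ne_top _ _ T) ENNReal.zero_ne_top]
  exact squeeze_zero' (Eventually.of_forall fun _ => ENNReal.toReal_nonneg)
    ((eventually_ge_atTop 2).mono h) hlim

lemma uniformSampling_expectedProportion (T : ℕ) :
    uniformSampling.expectedProportion μ 1 T = ((T / 2 : ℕ) : ℝ) / T := by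
  refine Eq.trans ?_ (pmfMean_const (uniformSampling.historyLaw μ T T) _)
  refine le_antisymm (pmfMean_mono fun h hh => ?_) (pmfMean_mono fun h hh => ?_) <;>
    rw [(uniformSampling_pulls μ T T h hh).2]

lemma uniformSampling_eventuallyBalanced (π : ℕ → Instance) :
    uniformSampling.EventuallyBalanced π := by
  intro ε hε
  refine Eventually.of_forall fun n => ?_
  filter_upwards [tendsto_inv_atTop_nhds_zero_nat.eventually_lt_const hε,
    eventually_gt_atTop 0] with T hT hT0
  have hT0' : (0 : ℝ) < T := Nat.cast_pos.2 hT0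
  rw [uniformSampling_expectedProportion]
  refine lt_of_le_of_lt ?_ hT
  have h1 : ((T / 2 : ℕ) : ℝ) * 2 ≤ T := by exact_mod_cast Nat.div_mul_le_self T 2
  have h2 : (T : ℝ) ≤ ((T / 2 : ℕ) : ℝ) * 2 + 1 := by
    exact_mod_cast (by omega : T ≤ T / 2 * 2 + 1)
  have h3 : ((T / 2 : ℕ) : ℝ) / T - 1 / 2 = (((T / 2 : ℕ) : ℝ) - T / 2) * (T : ℝ)⁻¹ := by
    field_simp
  rw [h3, abs_mul, abs_of_pos (inv_pos.2 hT0')]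
  refine mul_le_of_le_one_left (inv_pos.2 hT0').le ?_
  rw [abs_le]
  constructor <;> linarith

lemma uniformSampling_isStable : uniformSampling.IsStable := by
  intro a ha
  -- One mean stays at `a` and the other is raised by this amount; the shift by 2 keeps it below 1
  -- already at `n = 0`.
  have hδ : ∀ n : ℕ, 0 < (1 - a) * ((n : ℝ) + 2)⁻¹ ∧ a + (1 - a) * ((n : ℝ) + 2)⁻¹ < 1 := by
    intro n
    have h0 : 0 < 1 - a := sub_pos.2 ha.2
    have h1 : ((n : ℝ) + 2)⁻¹ < 1 := inv_lt_one_of_one_lt₀ (by linarith [n.cast_nonneg (α := ℝ)])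
    exact ⟨by positivity, by nlinarith⟩
  have hlim : Tendsto (fun n : ℕ => a + (1 - a) * ((n : ℝ) + 2)⁻¹) atTop (𝓝 a) := by
    have h : Tendsto (fun n : ℕ => ((n : ℝ) + 2)⁻¹) atTop (𝓝 0) :=
      tendsto_inv_atTop_zero.comp (tendsto_atTop_add_const_right _ _ tendsto_natCast_atTop_atTop)
    simpa using (h.const_mul (1 - a)).const_add a
  refine ⟨⟨fun n => ⟨![a + (1 - a) * ((n : ℝ) + 2)⁻¹, a], ?_, ?_⟩, ?_, ?_,
    uniformSampling_eventuallyBalanced _⟩, ⟨fun n => ⟨![a, a + (1 - a) * ((n : ℝ) + 2)⁻¹], ?_, ?_⟩,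
    ?_, ?_, uniformSampling_eventuallyBalanced _⟩⟩
  · intro k
    fin_cases k
    · exact ⟨add_pos ha.1 (hδ n).1, (hδ n).2⟩
    · exact ha
  · exact (lt_add_of_pos_right a (hδ n).1).ne'
  · exact fun n => lt_add_of_pos_right a (hδ n).1
  · refine tendsto_pi_nhds.2 fun k => ?_
    fin_cases k
    · exact hlim
    · exact tendsto_const_nhds
  · intro k
    fin_cases k
    · exact ha
    · exact ⟨add_pos ha.1 (hδ n).1, (hδ n).2⟩
  · exact (lt_add_of_pos_right a (hδ n).1).ne
  · exact fun n => lt_add_of_pos_right a (hδ n).1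
  · refine tendsto_pi_nhds.2 fun k => ?_
    fin_cases k
    · exact tendsto_const_nhds
    · exact hlim

lemma le_liminf_errorRate_uniformSampling :
    (g (1 / 2) μ : EReal) ≤ liminf (uniformSampling.errorRate μ) atTop := by
  refine (EReal.coe_le_coe_iff.2 (g_half_le_neg_log μ)).trans ?_
  have hρ := bhattacharyya_pos (μ.mean_mem 0) (μ.mean_mem 1)
  obtain ⟨C, hC, h⟩ := exists_errorProb_uniformSampling_le μ
  set ρ := bhattacharyya (μ.mean 0) (μ.mean 1)
  have hlim : Tendsto (fun T : ℕ => ((-Real.log C * (T : ℝ)⁻¹ - Real.log ρ : ℝ) : EReal)) atTop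
      (𝓝 ((-Real.log ρ : ℝ) : EReal)) := by
    refine (continuous_coe_real_ereal.tendsto _).comp ?_
    simpa using
      (tendsto_inv_atTop_nhds_zero_nat (𝕜 := ℝ)).const_mul (-Real.log C) |>.sub_const (Real.log ρ)
  rw [← hlim.liminf_eq]
  refine liminf_le_liminf ?_
  filter_upwards [eventually_ge_atTop 2] with T hT
  have hT0 : (0 : ℝ) < T := by positivity
  have hp : uniformSampling.errorProb μ T ≤ ENNReal.ofReal (C * ρ ^ T) :=
    (ENNReal.le_ofReal_iff_toReal_le (errorProb_ne_top _ _ T) (by positivity)).2 (h T hT)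
  have hlog := ENNReal.log_le_log hp
  rw [ENNReal.log_ofReal_of_pos (by positivity)] at hlog
  have heq : -Real.log C * (T : ℝ)⁻¹ - Real.log ρ = -Real.log (C * ρ ^ T) / T := by
    rw [Real.log_mul hC.ne' (pow_pos hρ T).ne', Real.log_pow]
    field_simp
    ring
  rw [heq, EReal.coe_div, EReal.coe_neg, errorRate]
  exact EReal.div_le_div_right_of_nonneg (by positivity) (EReal.neg_le_neg_iff.2 hlog)

end Algorithm

end TwoArmBandit

theorem mainTheorem3 (A : TwoArmBandit.Algorithm) (hcons : A.IsConsistent) (hstab : A.IsStable)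
    (μ : TwoArmBandit.Instance) :
    limsup (A.errorRate μ) atTop ≤ (TwoArmBandit.g (1 / 2) μ : EReal) ∧
      Tendsto (TwoArmBandit.Algorithm.uniformSampling.errorRate μ) atTop
        (𝓝 (TwoArmBandit.g (1 / 2) μ : EReal)) :=
  ⟨TwoArmBandit.Algorithm.limsup_errorRate_le hcons hstab μ,
    tendsto_of_le_liminf_of_limsup_le
      (TwoArmBandit.Algorithm.le_liminf_errorRate_uniformSampling μ)
      (TwoArmBandit.Algorithm.limsup_errorRate_le
        TwoArmBandit.Algorithm.uniformSampling_isConsistent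
        TwoArmBandit.Algorithm.uniformSampling_isStable μ)⟩
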